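/- Let $\mathbb D$ be the open unit disc in $\mathbb C$ and $H(\mathbb D)$ the space of holomorphic functions on $\mathbb D$. Let $\mu$ be a positive finite Borel measure on $[0,1)$, with moments $\mu_n=\int_{[0,1)}t^n\,d\mu(t)$, $n\ge 0$, and let $C_\mu\colon H(\mathbb D)\to H(\mathbb D)$ be the operator $$C_\mu(f)(z)=\sum_{n=0}^\infty \mu_n\Big(\sum_{k=0}^n a_k\Big)z^n,\qquad f(z)=\sum_{n=0}^\infty a_nz^n,\quad z\in\mathbb D.$$ A weight on $\mathbb D$ is a function $v\colon\mathbb D\to(0,\infty)$ that is radial ($v(z)$ depends only on $|z|$), continuous, decreasing (in the wide sense) with respect to $|z|$, and satisfies $\lim_{|z|\to1^-}v(z)=0$. For a weight $v$ put $$H_v^\infty=\{f\in H(\mathbb D):\ \|f\|_v:=\sup_{z\in\mathbb D}v(z)|f(z)|<\infty\},\qquad H_v^0=\{f\in H_v^\infty:\ \lim_{|z|\to1^-}v(z)|f(z)|=0\},$$ both normed by $\|\cdot\|_v$. **Proposition.** Let $\mu$ be a positive finite Borel measure on $[0,1)$ and let $v,w$ be weights on $\mathbb D$ such that $C_\mu$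 maps $H_v^0$ into $H_w^0$ and $C_\mu\colon H_v^0\to H_w^0$ is continuous. Then $C_\mu$ also maps $H_v^\infty$ continuously into $H_w^\infty$, and each of the two operators $C_\mu\colon H_v^0\to H_w^0$ and $C_\mu\colon H_v^\infty\to H_w^\infty$ is compact if and only if $C_\mu(H_v^\infty)\subseteq H_w^0$. (In particular, both are compact if and only if $C_\mu(H_v^\infty)\subseteq H_w^0$.) -/

import Mathlib

open MeasureTheory Filter Topology
open scoped Complex.UnitDisc Nat

noncomputable section

namespace WeightedCesaro

/-- The extension of a function on the open unit disc `𝔻` to the plane, by `0` off the disc. It is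
only used to speak of complex differentiability on `𝔻` and of derivatives at points of `𝔻`. -/
def zeroExt (f : 𝔻 → ℂ) (z : ℂ) : ℂ :=
  if h : ‖z‖ < 1 then f (Complex.UnitDisc.mk z h) else 0

theorem zeroExt_coe (f : 𝔻 → ℂ) (z : 𝔻) : zeroExt f z = f z := by
  have h : ‖(z : ℂ)‖ < 1 := z.norm_lt_one
  simp only [zeroExt, dif_pos h]
  rfl

theorem zeroExt_add (f g : 𝔻 → ℂ) : zeroExt (f + g) = zeroExt f + zeroExt g := by
  funext z
  by_cases h : ‖z‖ < 1 <;> simp [zeroExt, h]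

theorem zeroExt_smul (c : ℂ) (f : 𝔻 → ℂ) : zeroExt (c • f) = c • zeroExt f := by
  funext z
  by_cases h : ‖z‖ < 1 <;> simp [zeroExt, h]

/-- The vector space `H(𝔻)` of holomorphic functions on the open unit disc. -/
def Hol : Submodule ℂ (𝔻 → ℂ) where
  carrier := {f | DifferentiableOn ℂ (zeroExt f) (Metric.ball 0 1)}
  add_mem' {f g} hf hg := by
    simp only [Set.mem_ofPred_eq, zeroExt_add] at *
    exact hf.add hg
  zero_mem' := by
    have h : zeroExt (0 : 𝔻 → ℂ) = fun _ => 0 := by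
      funext z
      simp [zeroExt]
    simp only [Set.mem_ofPred_eq, h]
    exact differentiableOn_const 0
  smul_mem' c f hf := by
    simp only [Set.mem_ofPred_eq, zeroExt_smul] at *
    exact hf.const_smul c

/-- The `n`-th Taylor coefficient at `0`, so that `f z = ∑ aₙ zⁿ` on the disc. -/
def coeff (f : Hol) (n : ℕ) : ℂ := iteratedDeriv n (zeroExt f) 0 / (n ! : ℂ)

theorem hasSum_coeff (f : Hol) (z : 𝔻) :
    HasSum (fun n : ℕ => coeff f n * (z : ℂ) ^ n) ((f : 𝔻 → ℂ) z) := by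
  have hz : (z : ℂ) ∈ Metric.ball (0 : ℂ) 1 := by simpa using z.norm_lt_one
  have h := Complex.hasSum_taylorSeries_on_ball f.2 hz
  rw [zeroExt_coe] at h
  refine h.congr_fun ?_
  intro n
  simp only [coeff, sub_zero, smul_eq_mul]
  ring

theorem contDiffAt_zeroExt (f : Hol) (n : ℕ) : ContDiffAt ℂ n (zeroExt f) 0 :=
  (f.2.analyticAt (Metric.ball_mem_nhds 0 one_pos)).contDiffAt

theorem coeff_add (f g : Hol) (n : ℕ) : coeff (f + g) n = coeff f n + coeff g n := by
  simp only [coeff, Submodule.coe_add, zeroExt_add]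
  rw [iteratedDeriv_add (contDiffAt_zeroExt f n) (contDiffAt_zeroExt g n), add_div]

theorem coeff_smul (c : ℂ) (f : Hol) (n : ℕ) : coeff (c • f) n = c * coeff f n := by
  simp only [coeff, Submodule.coe_smul, zeroExt_smul]
  rw [iteratedDeriv_const_smul (contDiffAt_zeroExt f n) c, smul_eq_mul, mul_div_assoc]

/-- The moment `μₙ = ∫ tⁿ dμ(t)` of a measure on `[0,1)`. -/
def moment (μ : Measure (Set.Ico (0 : ℝ) 1)) (n : ℕ) : ℝ := ∫ t, (t : ℝ) ^ n ∂μ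

/-- The function `z ↦ ∑ₙ μₙ (a₀ + ⋯ + aₙ) zⁿ`, where `f z = ∑ₙ aₙ zⁿ`. -/
def cesaroFun (μ : Measure (Set.Ico (0 : ℝ) 1)) (f : Hol) (z : 𝔻) : ℂ :=
  ∑' n : ℕ, (moment μ n : ℂ) * (∑ k ∈ Finset.range (n + 1), coeff f k) * (z : ℂ) ^ n

theorem norm_moment_le (μ : Measure (Set.Ico (0 : ℝ) 1)) [IsFiniteMeasure μ] (n : ℕ) :
    ‖(moment μ n : ℂ)‖ ≤ μ.real Set.univ := by
  rw [Complex.norm_real, moment]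
  refine (norm_integral_le_of_norm_le_const (C := 1) (Eventually.of_forall fun t => ?_)).trans ?_
  · rw [norm_pow, Real.norm_of_nonneg t.2.1]
    exact pow_le_one₀ t.2.1 t.2.2.le
  · simp

theorem summable_partial (f : Hol) {s : ℝ} (hs0 : 0 ≤ s) (hs1 : s < 1) :
    Summable fun n : ℕ => ‖∑ k ∈ Finset.range (n + 1), coeff f k‖ * s ^ n := by
  have hs : ‖(s : ℂ)‖ < 1 := by rwa [Complex.norm_real, Real.norm_of_nonneg hs0]
  have h1 : Summable fun n : ℕ => ‖coeff f n * (s : ℂ) ^ n‖ :=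
    (hasSum_coeff f (Complex.UnitDisc.mk (s : ℂ) hs)).summable.norm
  have h2 : Summable fun n : ℕ => ‖(s : ℂ) ^ n‖ := (summable_geometric_of_norm_lt_one hs).norm
  refine (summable_norm_sum_mul_range_of_summable_norm h1 h2).congr fun n => ?_
  have h3 : ∑ k ∈ Finset.range (n + 1), coeff f k * (s : ℂ) ^ k * (s : ℂ) ^ (n - k)
      = (∑ k ∈ Finset.range (n + 1), coeff f k) * (s : ℂ) ^ n := by
    rw [Finset.sum_mul]
    refine Finset.sum_congr rfl fun k hk => ?_
    rw [mul_assoc, ← pow_add, Nat.add_sub_cancel' (by simpa [Nat.lt_succ_iff] using hk)]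
  rw [h3, norm_mul, norm_pow, Complex.norm_real, Real.norm_of_nonneg hs0]

theorem norm_term_le (μ : Measure (Set.Ico (0 : ℝ) 1)) [IsFiniteMeasure μ] (f : Hol) {s : ℝ}
    {z : ℂ} (hz : ‖z‖ ≤ s) (n : ℕ) :
    ‖(moment μ n : ℂ) * (∑ k ∈ Finset.range (n + 1), coeff f k) * z ^ n‖ ≤
      μ.real Set.univ * (‖∑ k ∈ Finset.range (n + 1), coeff f k‖ * s ^ n) := by
  rw [norm_mul, norm_mul, norm_pow, mul_assoc]
  have := norm_moment_le μ n
  gcongr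

/-- The series defining `C_μ f` converges at every point of the disc. -/
theorem summable_cesaro (μ : Measure (Set.Ico (0 : ℝ) 1)) [IsFiniteMeasure μ] (f : Hol) (z : 𝔻) :
    Summable fun n : ℕ =>
      (moment μ n : ℂ) * (∑ k ∈ Finset.range (n + 1), coeff f k) * (z : ℂ) ^ n :=
  Summable.of_norm_bounded
    ((summable_partial f (norm_nonneg (z : ℂ)) z.norm_lt_one).mul_left _)
    (norm_term_le μ f le_rfl)

/-- The sum `C_μ f` of that series is holomorphic on the disc. -/
theorem cesaroFun_mem (μ : Measure (Set.Ico (0 : ℝ) 1)) [IsFiniteMeasure μ] (f : Hol) :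
    cesaroFun μ f ∈ Hol := by
  intro z hz
  have hz1 : ‖z‖ < 1 := by simpa using hz
  obtain ⟨s, hzs, hs1⟩ := exists_between hz1
  have hs0 : 0 ≤ s := (norm_nonneg z).trans hzs.le
  have hd : DifferentiableOn ℂ (fun w : ℂ => ∑' n : ℕ,
      (moment μ n : ℂ) * (∑ k ∈ Finset.range (n + 1), coeff f k) * w ^ n) (Metric.ball 0 s) := by
    refine Complex.differentiableOn_tsum_of_summable_norm
      ((summable_partial f hs0 hs1).mul_left (μ.real Set.univ)) (fun n => ?_) Metric.isOpen_ball
      (fun n w hw => norm_term_le μ f (by simpa using (Metric.mem_ball.1 hw).le) n)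
    fun_prop
  have hzb : Metric.ball (0 : ℂ) s ∈ 𝓝 z := Metric.isOpen_ball.mem_nhds (by simpa using hzs)
  refine DifferentiableAt.differentiableWithinAt ?_
  refine (hd.differentiableAt hzb).congr_of_eventuallyEq ?_
  filter_upwards [hzb] with w hw
  have hw1 : ‖w‖ < 1 := lt_trans (by simpa using hw) hs1
  simp only [zeroExt, dif_pos hw1]
  rfl

/-- The Cesàro-type operator `C_μ : H(𝔻) → H(𝔻)`. -/
def cesaro (μ : Measure (Set.Ico (0 : ℝ) 1)) [IsFiniteMeasure μ] : Hol →ₗ[ℂ] Hol where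
  toFun f := ⟨cesaroFun μ f, cesaroFun_mem μ f⟩
  map_add' f g := by
    ext z
    simp only [Submodule.coe_add, Pi.add_apply, cesaroFun]
    rw [← (summable_cesaro μ f z).tsum_add (summable_cesaro μ g z)]
    refine tsum_congr fun n => ?_
    simp only [coeff_add, Finset.sum_add_distrib]
    ring
  map_smul' c f := by
    ext z
    simp only [Submodule.coe_smul, Pi.smul_apply, smul_eq_mul, RingHom.id_apply, cesaroFun]
    rw [← tsum_mul_left]
    refine tsum_congr fun n => ?_
    simp only [coeff_smul, ← Finset.mul_sum]
    ring

/-- A weight on `𝔻`: a positive, radial, continuous function, decreasing (in the wide sense) with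
respect to `|z|`, that tends to `0` at the boundary. -/
structure Weight where
  toFun : 𝔻 → ℝ
  pos : ∀ z, 0 < toFun z
  radial : ∀ z w : 𝔻, ‖(z : ℂ)‖ = ‖(w : ℂ)‖ → toFun z = toFun w
  continuous : Continuous toFun
  decreasing : ∀ z w : 𝔻, ‖(z : ℂ)‖ ≤ ‖(w : ℂ)‖ → toFun w ≤ toFun z
  tendsto_zero : Tendsto toFun (comap (fun z : 𝔻 => ‖(z : ℂ)‖) (𝓝[<] 1)) (𝓝 0)

/-- The subspace of those `f ∈ H(𝔻)` with `sup_z v(z) |f(z)| < ∞`. -/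
def growthSubmodule (v : Weight) : Submodule ℂ Hol where
  carrier := {f | BddAbove (Set.range fun z : 𝔻 => v.toFun z * ‖(f : 𝔻 → ℂ) z‖)}
  add_mem' {f g} hf hg := by
    obtain ⟨A, hA⟩ := hf
    obtain ⟨B, hB⟩ := hg
    refine ⟨A + B, ?_⟩
    rintro _ ⟨z, rfl⟩
    have h1 : v.toFun z * ‖(f : 𝔻 → ℂ) z‖ ≤ A := hA ⟨z, rfl⟩
    have h2 : v.toFun z * ‖(g : 𝔻 → ℂ) z‖ ≤ B := hB ⟨z, rfl⟩
    calc v.toFun z * ‖(f : 𝔻 → ℂ) z + (g : 𝔻 → ℂ) z‖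
        ≤ v.toFun z * (‖(f : 𝔻 → ℂ) z‖ + ‖(g : 𝔻 → ℂ) z‖) :=
          mul_le_mul_of_nonneg_left (norm_add_le _ _) (v.pos z).le
      _ ≤ A + B := by rw [mul_add]; exact add_le_add h1 h2
  zero_mem' := by
    refine ⟨0, ?_⟩
    rintro _ ⟨z, rfl⟩
    simp
  smul_mem' c f hf := by
    obtain ⟨A, hA⟩ := hf
    refine ⟨‖c‖ * A, ?_⟩
    rintro _ ⟨z, rfl⟩
    have h1 : v.toFun z * ‖(f : 𝔻 → ℂ) z‖ ≤ A := hA ⟨z, rfl⟩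
    calc v.toFun z * ‖c • (f : 𝔻 → ℂ) z‖ = ‖c‖ * (v.toFun z * ‖(f : 𝔻 → ℂ) z‖) := by
          rw [norm_smul]; ring
      _ ≤ ‖c‖ * A := mul_le_mul_of_nonneg_left h1 (norm_nonneg c)

/-- The space `H_v^∞`. It is a type of its own, so that its only topology is that of its norm. -/
def HInf (v : Weight) : Type := growthSubmodule v

instance (v : Weight) : AddCommGroup (HInf v) := inferInstanceAs (AddCommGroup (growthSubmodule v))

instance (v : Weight) : Module ℂ (HInf v) := inferInstanceAs (Module ℂ (growthSubmodule v))

/-- The inclusion `H_v^∞ ⊆ H(𝔻)`. -/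
def HInf.toHol {v : Weight} : HInf v →ₗ[ℂ] Hol := (growthSubmodule v).subtype

/-- The norm `‖f‖_v = sup_z v(z) |f(z)|`. -/
instance (v : Weight) : Norm (HInf v) where
  norm f := ⨆ z : 𝔻, v.toFun z * ‖(f.toHol : 𝔻 → ℂ) z‖

theorem HInf.le_norm {v : Weight} (f : HInf v) (z : 𝔻) :
    v.toFun z * ‖(f.toHol : 𝔻 → ℂ) z‖ ≤ ‖f‖ :=
  le_ciSup (f := fun z : 𝔻 => v.toFun z * ‖(f.toHol : 𝔻 → ℂ) z‖) f.2 z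

theorem HInf.normedCore (v : Weight) : NormedSpace.Core ℂ (HInf v) where
  norm_nonneg f := Real.iSup_nonneg fun z => mul_nonneg (v.pos z).le (norm_nonneg _)
  norm_smul c f := by
    change (⨆ z : 𝔻, v.toFun z * ‖((c • f).toHol : 𝔻 → ℂ) z‖) =
      ‖c‖ * ⨆ z : 𝔻, v.toFun z * ‖(f.toHol : 𝔻 → ℂ) z‖
    rw [Real.mul_iSup_of_nonneg (norm_nonneg c)]
    congr 1
    funext z
    simp only [map_smul, Submodule.coe_smul, Pi.smul_apply, norm_smul]
    ring
  norm_triangle f g := by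
    refine ciSup_le fun z => ?_
    refine le_trans ?_ (add_le_add (HInf.le_norm f z) (HInf.le_norm g z))
    rw [← mul_add]
    refine mul_le_mul_of_nonneg_left ?_ (v.pos z).le
    simp only [map_add, Submodule.coe_add, Pi.add_apply]
    exact norm_add_le _ _
  norm_eq_zero_iff f := by
    constructor
    · intro h
      apply Subtype.ext
      apply Subtype.ext
      funext z
      have h1 := HInf.le_norm f z
      rw [h] at h1
      have h2 : ‖(f.toHol : 𝔻 → ℂ) z‖ ≤ 0 := nonpos_of_mul_nonpos_right h1 (v.pos z)
      exact norm_le_zero_iff.1 h2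
    · rintro rfl
      change (⨆ z : 𝔻, v.toFun z * ‖((0 : HInf v).toHol : 𝔻 → ℂ) z‖) = 0
      simp

instance (v : Weight) : NormedAddCommGroup (HInf v) := NormedAddCommGroup.ofCore (HInf.normedCore v)

instance (v : Weight) : NormedSpace ℂ (HInf v) := NormedSpace.ofCore (HInf.normedCore v)

/-- The subspace `H_v^0` of `H_v^∞`, with the norm of `H_v^∞`: the functions `f` for which
`v(z) |f(z)| → 0` as `|z| → 1⁻`. -/
def HZero (v : Weight) : Submodule ℂ (HInf v) where
  carrier := {f | Tendsto (fun z : 𝔻 => v.toFun z * ‖(f.toHol : 𝔻 → ℂ) z‖)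
    (comap (fun z : 𝔻 => ‖(z : ℂ)‖) (𝓝[<] 1)) (𝓝 0)}
  add_mem' {f g} hf hg := by
    have h := Tendsto.add hf hg
    rw [add_zero] at h
    refine squeeze_zero (fun z => mul_nonneg (v.pos z).le (norm_nonneg _)) (fun z => ?_) h
    rw [← mul_add]
    refine mul_le_mul_of_nonneg_left ?_ (v.pos z).le
    simp only [map_add, Submodule.coe_add, Pi.add_apply]
    exact norm_add_le _ _
  zero_mem' := by
    refine tendsto_const_nhds.congr fun z => ?_
    simp
  smul_mem' c f hf := by
    have h := Tendsto.const_mul ‖c‖ hf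
    rw [mul_zero] at h
    refine h.congr fun z => ?_
    simp only [map_smul, Submodule.coe_smul, Pi.smul_apply, norm_smul]
    ring

end WeightedCesaro

end

noncomputable section

namespace WeightedCesaro

/-! Everything is tested on the dilations `D_r f = f(r ·)`. They are contractions of `H_v^∞`,
because `v` decreases, and they take values in `H_v^0`, because `v → 0` at the boundary. They are
also compact, and `D_r f → f` locally uniformly as `r → 1`. By Cauchy's estimates `C_μ` respects
locally uniform convergence, so `C_μ (D_r f) → C_μ f` pointwise; the bound on `H_v^0` therefore
passes to `H_v^∞` (`exists_extension`).

If `T₀` is compact, a subsequence of `C_μ (D_r f)` converges in the norm of `H_w^0`, and its limit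
can only be `C_μ f` (`forall_mem_HZero_of_isCompactOperator`).

Conversely, let `C_μ` map `H_v^∞` into `H_w^0`. If `T` were not the norm limit of the compact
operators `T ∘ D_r`, the functions `f - D_r f`, normalised and dilated once more, would lie in the
unit ball of `H_v^0`, be arbitrarily small on compact sets and have large images. A gliding hump
(`exists_notMem_HZero`) would sum such functions to an element of `H_v^∞` whose image is not in
`H_w^0`. -/

/-! ### Weights and local estimates for `C_μ` -/

theorem tendsto_boundary_iff {F : 𝔻 → ℝ} (hF : ∀ z, 0 ≤ F z) :
    Tendsto F (comap (fun z : 𝔻 => ‖(z : ℂ)‖) (𝓝[<] 1)) (𝓝 0) ↔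
      ∀ ε > 0, ∃ ρ < 1, ∀ z : 𝔻, ρ < ‖(z : ℂ)‖ → F z < ε := by
  rw [((nhdsLT_basis (1 : ℝ)).comap _).tendsto_iff Metric.nhds_basis_ball]
  refine forall₂_congr fun ε _ => exists_congr fun ρ => and_congr_right fun _ =>
    forall_congr' fun z => ?_
  simp [z.norm_lt_one, abs_of_nonneg (hF z)]

theorem Weight.exists_pos_le (v : Weight) {ρ : ℝ} (hρ : ρ < 1) :
    ∃ c > 0, ∀ z : 𝔻, ‖(z : ℂ)‖ ≤ ρ → c ≤ v.toFun z := by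
  have h : ‖((max ρ 0 : ℝ) : ℂ)‖ < 1 := by
    rw [Complex.norm_real, Real.norm_of_nonneg (le_max_right _ _)]
    exact max_lt hρ one_pos
  refine ⟨v.toFun (Complex.UnitDisc.mk _ h), v.pos _, fun z hz => v.decreasing _ _ ?_⟩
  rw [Complex.UnitDisc.coe_mk, Complex.norm_real, Real.norm_of_nonneg (le_max_right _ _)]
  exact hz.trans (le_max_left _ _)

theorem Weight.le_zero (v : Weight) (z : 𝔻) : v.toFun z ≤ v.toFun 0 :=
  v.decreasing 0 z (by simp)

theorem Weight.le_mul_left (v : Weight) (r z : 𝔻) : v.toFun z ≤ v.toFun (r * z) := by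
  refine v.decreasing _ _ ?_
  rw [Complex.UnitDisc.coe_mul, norm_mul]
  exact mul_le_of_le_one_left (norm_nonneg _) r.norm_lt_one.le

theorem norm_coeff_le (f : Hol) {ρ B : ℝ} (hρ0 : 0 < ρ) (hρ1 : ρ < 1)
    (hf : ∀ z : 𝔻, ‖(z : ℂ)‖ ≤ ρ → ‖(f : 𝔻 → ℂ) z‖ ≤ B) (n : ℕ) : ‖coeff f n‖ ≤ B / ρ ^ n := by
  have hd : DiffContOnCl ℂ (zeroExt f) (Metric.ball 0 ρ) :=
    (f.2.mono (Metric.closedBall_subset_ball hρ1)).diffContOnCl_ball subset_rfl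
  have h := Complex.norm_iteratedDeriv_le_of_forall_mem_sphere_norm_le (C := B) n hρ0 hd
    fun z hz => by
      have hz' : ‖z‖ = ρ := by simpa using hz
      have hz1 : ‖z‖ < 1 := hz'.trans_lt hρ1
      simpa [zeroExt_coe] using (zeroExt_coe f (Complex.UnitDisc.mk z hz1)).symm ▸
        hf (Complex.UnitDisc.mk z hz1) (by simpa using hz'.le)
  have hn : (0 : ℝ) < n ! := by exact_mod_cast n.factorial_pos
  rw [coeff, norm_div, Complex.norm_natCast, div_le_iff₀ hn]
  exact h.trans_eq (by ring)

theorem summable_succ_mul_geometric {q : ℝ} (hq0 : 0 ≤ q) (hq1 : q < 1) :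
    Summable fun n : ℕ => ((n : ℝ) + 1) * q ^ n := by
  have h1 := summable_pow_mul_geometric_of_norm_lt_one 1 (r := q)
    (by rwa [Real.norm_of_nonneg hq0])
  refine (h1.add (summable_geometric_of_lt_one hq0 hq1)).congr fun n => ?_
  ring

/-- The values of `C_μ f` on a smaller disc are controlled by those of `f` on a larger one. -/
theorem exists_norm_cesaro_le (μ : Measure (Set.Ico (0 : ℝ) 1)) [IsFiniteMeasure μ] {s ρ : ℝ}
    (hs0 : 0 ≤ s) (hsρ : s < ρ) (hρ1 : ρ < 1) :
    ∃ K > 0, ∀ (f : Hol) (B : ℝ), (∀ z : 𝔻, ‖(z : ℂ)‖ ≤ ρ → ‖(f : 𝔻 → ℂ) z‖ ≤ B) →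
      ∀ z : 𝔻, ‖(z : ℂ)‖ ≤ s → ‖(cesaro μ f : 𝔻 → ℂ) z‖ ≤ K * B := by
  have hρ0 : 0 < ρ := hs0.trans_lt hsρ
  have hS := summable_succ_mul_geometric (q := s / ρ) (by positivity) ((div_lt_one hρ0).2 hsρ)
  set M := μ.real Set.univ
  -- The summand `1` only serves to make the constant strictly positive.
  refine ⟨M * (∑' n : ℕ, ((n : ℝ) + 1) * (s / ρ) ^ n) + 1, by positivity, fun f B hB z hz => ?_⟩
  have hB0 : 0 ≤ B := (norm_nonneg _).trans (hB 0 (by simpa using hρ0.le))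
  have hS' := (hS.hasSum.mul_left M).mul_right B
  refine (tsum_of_norm_bounded hS' fun n => (norm_term_le μ f hz n).trans ?_).trans
    (by rw [add_mul]; linarith)
  -- Cauchy's estimate `B / ρ ^ k` is largest at `k = n`, since `ρ < 1`.
  have h1 : ‖∑ k ∈ Finset.range (n + 1), coeff f k‖ ≤ ((n : ℝ) + 1) * (B / ρ ^ n) := by
    refine (norm_sum_le_of_le (f := coeff f) (n := fun _ => B / ρ ^ n) _ fun k hk => ?_).trans_eq
      (by simp)
    refine (norm_coeff_le f hρ0 hρ1 hB k).trans ?_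
    refine div_le_div_of_nonneg_left hB0 (by positivity) ?_
    exact pow_le_pow_of_le_one hρ0.le hρ1.le (Nat.lt_succ_iff.1 (Finset.mem_range.1 hk))
  have hM : 0 ≤ M := measureReal_nonneg
  calc M * (‖∑ k ∈ Finset.range (n + 1), coeff f k‖ * s ^ n)
      ≤ M * (((n : ℝ) + 1) * (B / ρ ^ n) * s ^ n) := by gcongr
    _ = M * (((n : ℝ) + 1) * (s / ρ) ^ n) * B := by rw [div_pow]; ring

/-! ### Point evaluations, locally uniform limits and completeness -/

/-- Evaluation at a point of the disc, as a continuous functional on `H_v^∞`. -/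
def pointEval {v : Weight} (z : 𝔻) : HInf v →L[ℂ] ℂ :=
  LinearMap.mkContinuous
    { toFun := fun f => (f.toHol : 𝔻 → ℂ) z
      map_add' := fun f g => by simp
      map_smul' := fun c f => by simp }
    (v.toFun z)⁻¹ fun f => by
      rw [inv_mul_eq_div, le_div_iff₀' (v.pos z)]
      exact HInf.le_norm f z

variable {v w : Weight}

theorem pointEval_apply (z : 𝔻) (f : HInf v) : pointEval z f = (f.toHol : 𝔻 → ℂ) z := rfl

theorem HInf.ext_pointEval {f g : HInf v} (h : ∀ z, pointEval z f = pointEval z g) : f = g :=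
  Subtype.ext (Subtype.ext (funext h))

theorem mul_norm_pointEval_le (z : 𝔻) (f : HInf v) : v.toFun z * ‖pointEval z f‖ ≤ ‖f‖ :=
  HInf.le_norm f z

theorem norm_le_of_pointEval {f : HInf v} {M : ℝ}
    (h : ∀ z, v.toFun z * ‖pointEval z f‖ ≤ M) : ‖f‖ ≤ M :=
  ciSup_le h

theorem exists_lt_of_lt_norm {f : HInf v} {M : ℝ} (h : M < ‖f‖) :
    ∃ z, M < v.toFun z * ‖pointEval z f‖ := by
  by_contra! h'
  exact (norm_le_of_pointEval h').not_gt h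

theorem exists_norm_pointEval_le (v : Weight) {ρ : ℝ} (hρ : ρ < 1) :
    ∃ K > 0, ∀ (f : HInf v) (z : 𝔻), ‖(z : ℂ)‖ ≤ ρ → ‖pointEval z f‖ ≤ K * ‖f‖ := by
  obtain ⟨c, hc, h⟩ := v.exists_pos_le hρ
  refine ⟨c⁻¹, by positivity, fun f z hz => ?_⟩
  rw [inv_mul_eq_div, le_div_iff₀' hc]
  exact (mul_le_mul_of_nonneg_right (h z hz) (norm_nonneg _)).trans (mul_norm_pointEval_le z f)

theorem mem_HZero_iff {f : HInf v} : f ∈ HZero v ↔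
    ∀ ε > 0, ∃ ρ < 1, ∀ z : 𝔻, ρ < ‖(z : ℂ)‖ → v.toFun z * ‖pointEval z f‖ < ε :=
  tendsto_boundary_iff fun z => mul_nonneg (v.pos z).le (norm_nonneg _)

theorem isClosed_HZero (v : Weight) : IsClosed (HZero v : Set (HInf v)) := by
  refine isClosed_of_closure_subset fun f hf => mem_HZero_iff.2 fun ε hε => ?_
  obtain ⟨g, hg, hfg⟩ := Metric.mem_closure_iff.1 hf (ε / 2) (half_pos hε)
  obtain ⟨ρ, hρ, h⟩ := mem_HZero_iff.1 hg (ε / 2) (half_pos hε)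
  refine ⟨ρ, hρ, fun z hz => ?_⟩
  have h1 := mul_norm_pointEval_le z (f - g)
  rw [← dist_eq_norm] at h1
  have h2 : ‖pointEval z f‖ ≤ ‖pointEval z (f - g)‖ + ‖pointEval z g‖ := by
    rw [map_sub]; simpa using norm_add_le (pointEval z f - pointEval z g) (pointEval z g)
  have h3 := mul_le_mul_of_nonneg_left h2 (v.pos z).le
  have h4 := h z hz
  linarith

/-- A norm-bounded sequence that is uniformly Cauchy on compact subsets of the disc has a limit in
`H_v^∞`. -/
theorem exists_limit_of_locally_cauchy {F : ℕ → HInf v} {M : ℝ} (hM : ∀ n, ‖F n‖ ≤ M)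
    (hF : ∀ ρ < 1, ∀ ε > 0, ∃ N, ∀ n ≥ N, ∀ m ≥ N, ∀ z : 𝔻, ‖(z : ℂ)‖ ≤ ρ →
      ‖pointEval z (F n) - pointEval z (F m)‖ ≤ ε) :
    ∃ G : HInf v, (∀ z, Tendsto (fun n => pointEval z (F n)) atTop (𝓝 (pointEval z G))) ∧
      ∀ ρ < 1, ∀ ε > 0, ∃ N, ∀ n ≥ N, ∀ z : 𝔻, ‖(z : ℂ)‖ ≤ ρ →
        ‖pointEval z (F n) - pointEval z G‖ ≤ ε := by
  have hc (z : 𝔻) : ∃ a, Tendsto (fun n => pointEval z (F n)) atTop (𝓝 a) := by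
    refine cauchySeq_tendsto_of_complete (Metric.cauchySeq_iff.2 fun ε hε => ?_)
    obtain ⟨N, hN⟩ := hF _ z.norm_lt_one (ε / 2) (half_pos hε)
    refine ⟨N, fun m hm n hn => ?_⟩
    rw [dist_eq_norm]
    exact (hN m hm n hn z le_rfl).trans_lt (half_lt_self hε)
  choose g hg using hc
  have hu : ∀ ρ < 1, ∀ ε > 0, ∃ N, ∀ n ≥ N, ∀ z : 𝔻, ‖(z : ℂ)‖ ≤ ρ →
      ‖pointEval z (F n) - g z‖ ≤ ε := fun ρ hρ ε hε => by
    obtain ⟨N, hN⟩ := hF ρ hρ ε hε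
    refine ⟨N, fun n hn z hz => ?_⟩
    refine le_of_tendsto ((hg z).const_sub (pointEval z (F n))).norm ?_
    filter_upwards [eventually_ge_atTop N] with m hm using hN n hn m hm z hz
  have hol : g ∈ Hol := by
    have hlu : TendstoLocallyUniformlyOn (fun n => zeroExt (F n).toHol) (zeroExt g) atTop
        (Metric.ball 0 1) := by
      rw [Metric.tendstoLocallyUniformlyOn_iff]
      intro ε hε x hx
      obtain ⟨ρ, hxρ, hρ⟩ := exists_between (show ‖x‖ < 1 by simpa using hx)
      obtain ⟨N, hN⟩ := hu ρ hρ (ε / 2) (half_pos hε)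
      refine ⟨Metric.ball 0 ρ,
        mem_nhdsWithin_of_mem_nhds (Metric.isOpen_ball.mem_nhds (by simpa using hxρ)), ?_⟩
      filter_upwards [eventually_ge_atTop N] with n hn y hy
      have hy' : ‖y‖ < ρ := by simpa using hy
      have h := hN n hn (Complex.UnitDisc.mk y (hy'.trans hρ)) (by simpa using hy'.le)
      rw [pointEval_apply, ← zeroExt_coe (F n).toHol, ← zeroExt_coe g, Complex.UnitDisc.coe_mk] at h
      rw [dist_comm, dist_eq_norm]
      exact h.trans_lt (half_lt_self hε)
    exact hlu.differentiableOn (Eventually.of_forall fun n => (F n).toHol.2) Metric.isOpen_ball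
  have hb : (⟨g, hol⟩ : Hol) ∈ growthSubmodule v := by
    refine ⟨M, ?_⟩
    rintro _ ⟨z, rfl⟩
    exact le_of_tendsto ((hg z).norm.const_mul (v.toFun z))
      (Eventually.of_forall fun n => (mul_norm_pointEval_le z (F n)).trans (hM n))
  exact ⟨(⟨⟨g, hol⟩, hb⟩ : growthSubmodule v), hg, hu⟩

/-- Needed for the dilation series to sum in operator norm and for norm limits of compact operators
to be compact. -/
instance (v : Weight) : CompleteSpace (HInf v) := by
  refine Metric.complete_of_cauchySeq_tendsto fun F hF => ?_
  obtain ⟨M, hM⟩ := hF.isBounded_range.exists_norm_le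
  obtain ⟨G, hG, -⟩ := exists_limit_of_locally_cauchy (F := F) (M := M) (fun n => hM _ ⟨n, rfl⟩)
    fun ρ hρ ε hε => by
      obtain ⟨K, hK, hKle⟩ := exists_norm_pointEval_le v hρ
      obtain ⟨N, hN⟩ := Metric.cauchySeq_iff.1 hF (ε / K) (by positivity)
      refine ⟨N, fun n hn m hm z hz => ?_⟩
      rw [← map_sub]
      refine (hKle _ z hz).trans ?_
      have := hN n hn m hm
      rw [dist_eq_norm, lt_div_iff₀' hK] at this
      exact this.le
  refine ⟨G, Metric.tendsto_atTop.2 fun ε hε => ?_⟩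
  obtain ⟨N, hN⟩ := Metric.cauchySeq_iff.1 hF (ε / 2) (half_pos hε)
  refine ⟨N, fun n hn => ?_⟩
  rw [dist_eq_norm]
  refine (norm_le_of_pointEval fun z => ?_).trans_lt (half_lt_self hε)
  rw [map_sub]
  refine le_of_tendsto (((hG z).const_sub _).norm.const_mul (v.toFun z)) ?_
  filter_upwards [eventually_ge_atTop N] with m hm
  rw [← map_sub]
  refine (mul_norm_pointEval_le z _).trans ?_
  rw [← dist_eq_norm]
  exact (hN n hn m hm).le

/-! ### Taylor coefficients and dilations -/

theorem exists_norm_coeff_le (v : Weight) {ρ : ℝ} (hρ0 : 0 < ρ) (hρ1 : ρ < 1) :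
    ∃ K > 0, ∀ (f : HInf v) (n : ℕ), ‖coeff f.toHol n‖ ≤ K / ρ ^ n * ‖f‖ := by
  obtain ⟨K, hK, h⟩ := exists_norm_pointEval_le v hρ1
  exact ⟨K, hK, fun f n => (norm_coeff_le f.toHol hρ0 hρ1 (h f) n).trans_eq (by ring)⟩

/-- The `n`-th Taylor coefficient, as a continuous functional on `H_v^∞`. -/
def coeffCLM (v : Weight) (n : ℕ) : HInf v →L[ℂ] ℂ :=
  LinearMap.mkContinuousOfExistsBound
    { toFun := fun f => coeff f.toHol n
      map_add' := fun f g => by rw [map_add, coeff_add]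
      map_smul' := fun c f => by rw [map_smul, coeff_smul]; rfl }
    (by
      obtain ⟨K, -, h⟩ := exists_norm_coeff_le v (ρ := 1 / 2) (by norm_num) (by norm_num)
      exact ⟨_, fun f => h f n⟩)

theorem coeffCLM_apply (n : ℕ) (f : HInf v) : coeffCLM v n f = coeff f.toHol n := rfl

theorem exists_norm_coeffCLM_le (v : Weight) {ρ : ℝ} (hρ0 : 0 < ρ) (hρ1 : ρ < 1) :
    ∃ K > 0, ∀ n : ℕ, ‖coeffCLM v n‖ ≤ K / ρ ^ n := by
  obtain ⟨K, hK, h⟩ := exists_norm_coeff_le v hρ0 hρ1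
  exact ⟨K, hK, fun n => ContinuousLinearMap.opNorm_le_bound _ (by positivity) fun f => h f n⟩

theorem hasSum_coeffCLM (f : HInf v) (z : 𝔻) :
    HasSum (fun n : ℕ => coeffCLM v n f * (z : ℂ) ^ n) (pointEval z f) :=
  hasSum_coeff f.toHol z

theorem monomial_mem_Hol (n : ℕ) : (fun z : 𝔻 => (z : ℂ) ^ n) ∈ Hol := by
  refine (differentiable_pow n).differentiableOn.congr fun z hz => ?_
  have hz' : ‖z‖ < 1 := by simpa using hz
  simp [zeroExt, hz']

theorem monomial_bound (v : Weight) (n : ℕ) (z : 𝔻) :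
    v.toFun z * ‖(z : ℂ) ^ n‖ ≤ v.toFun 0 := by
  rw [norm_pow]
  exact (mul_le_of_le_one_right (v.pos z).le
    (pow_le_one₀ (norm_nonneg _) z.norm_lt_one.le)).trans (v.le_zero z)

/-- The monomial `zⁿ` as an element of `H_v^∞`. -/
def monomial (v : Weight) (n : ℕ) : HInf v :=
  (⟨⟨_, monomial_mem_Hol n⟩, v.toFun 0, by rintro _ ⟨z, rfl⟩; exact monomial_bound v n z⟩ :
    growthSubmodule v)

theorem pointEval_monomial (n : ℕ) (z : 𝔻) : pointEval z (monomial v n) = (z : ℂ) ^ n := rfl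

theorem norm_monomial_le (v : Weight) (n : ℕ) : ‖monomial v n‖ ≤ v.toFun 0 :=
  norm_le_of_pointEval fun z => by rw [pointEval_monomial]; exact monomial_bound v n z

/-- The `n`-th term `f ↦ aₙ rⁿ zⁿ` of the expansion of the dilation operator. -/
def dilationTerm (v : Weight) (r : 𝔻) (n : ℕ) : HInf v →L[ℂ] HInf v :=
  (coeffCLM v n).smulRight ((r : ℂ) ^ n • monomial v n)

/-- The dilation operator `f ↦ f(r ·)` on `H_v^∞`. -/
def dilation (v : Weight) (r : 𝔻) : HInf v →L[ℂ] HInf v := ∑' n, dilationTerm v r n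

/-- Cauchy's estimate on a circle of radius `ρ > |r|` leaves a geometric series of ratio `|r| / ρ`.
-/
theorem summable_dilationTerm (v : Weight) (r : 𝔻) : Summable (dilationTerm v r) := by
  obtain ⟨ρ, hrρ, hρ1⟩ := exists_between r.norm_lt_one
  have hρ0 : 0 < ρ := (norm_nonneg _).trans_lt hrρ
  obtain ⟨K, hK, h⟩ := exists_norm_coeffCLM_le v hρ0 hρ1
  have hg : Summable fun n : ℕ => K * v.toFun 0 * (‖(r : ℂ)‖ / ρ) ^ n :=
    (summable_geometric_of_lt_one (by positivity) ((div_lt_one hρ0).2 hrρ)).mul_left _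
  refine Summable.of_norm_bounded hg fun n => ?_
  rw [dilationTerm, ContinuousLinearMap.norm_smulRight_apply, norm_smul, norm_pow]
  calc ‖coeffCLM v n‖ * (‖(r : ℂ)‖ ^ n * ‖monomial v n‖)
      ≤ K / ρ ^ n * (‖(r : ℂ)‖ ^ n * v.toFun 0) := by
        gcongr
        · exact h n
        · exact norm_monomial_le v n
    _ = _ := by rw [div_pow]; ring

theorem pointEval_dilation (r z : 𝔻) (f : HInf v) :
    pointEval z (dilation v r f) = pointEval (r * z) f := by
  have h1 := (summable_dilationTerm v r).hasSum.mapL (ContinuousLinearMap.apply ℂ (HInf v) f)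
  have h2 := h1.mapL (pointEval z)
  refine h2.unique ((hasSum_coeffCLM f (r * z)).congr_fun fun n => ?_)
  simp only [ContinuousLinearMap.apply_apply, dilationTerm, ContinuousLinearMap.smulRight_apply,
    map_smul, smul_eq_mul, pointEval_monomial, Complex.UnitDisc.coe_mul, mul_pow]

/-- The partial sums of the dilation series have finite rank and converge in operator norm. -/
theorem isCompactOperator_dilation (v : Weight) (r : 𝔻) : IsCompactOperator (dilation v r) := by
  refine isCompactOperator_of_tendsto (summable_dilationTerm v r).hasSum
    (Eventually.of_forall fun s => ?_)
  refine Submodule.sum_mem (compactOperator (RingHom.id ℂ) (HInf v) (HInf v)) fun n _ => ?_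
  change IsCompactOperator (dilationTerm v r n)
  exact (isCompactOperator_of_locallyCompactSpace_dom (coeffCLM v n)).clm_comp
    (ContinuousLinearMap.toSpanSingleton ℂ ((r : ℂ) ^ n • monomial v n))

theorem norm_dilation_le (r : 𝔻) (f : HInf v) : ‖dilation v r f‖ ≤ ‖f‖ :=
  norm_le_of_pointEval fun z => by
    rw [pointEval_dilation]
    exact (mul_le_mul_of_nonneg_right (v.le_mul_left r z) (norm_nonneg _)).trans
      (mul_norm_pointEval_le _ f)

theorem dilation_mem_HZero (r : 𝔻) (f : HInf v) : dilation v r f ∈ HZero v := by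
  obtain ⟨K, hK, h⟩ := exists_norm_pointEval_le v r.norm_lt_one
  have h0 := v.tendsto_zero.mul_const (K * ‖f‖)
  rw [zero_mul] at h0
  refine squeeze_zero (fun z => mul_nonneg (v.pos z).le (norm_nonneg _)) (fun z => ?_) h0
  refine mul_le_mul_of_nonneg_left ?_ (v.pos z).le
  rw [← pointEval_apply, pointEval_dilation]
  refine h f _ ?_
  rw [Complex.UnitDisc.coe_mul, norm_mul]
  exact mul_le_of_le_one_right (norm_nonneg _) z.norm_lt_one.le

theorem norm_one_sub_pow_le {r : ℂ} (hr : ‖r‖ ≤ 1) (n : ℕ) : ‖1 - r ^ n‖ ≤ n * ‖1 - r‖ := by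
  rw [← mul_neg_geom_sum, norm_mul, mul_comm]
  gcongr
  refine (norm_sum_le_of_le (n := fun _ => (1 : ℝ)) _ fun k _ => ?_).trans_eq (by simp)
  rw [norm_pow]
  exact pow_le_one₀ (norm_nonneg _) hr

/-- Dilations converge to the identity, uniformly on bounded subsets of `H_v^∞` and on compact
subsets of the disc. -/
theorem exists_norm_sub_dilation_le (v : Weight) {ρ : ℝ} (hρ0 : 0 ≤ ρ) (hρ1 : ρ < 1) :
    ∃ K > 0, ∀ (f : HInf v) (r z : 𝔻), ‖(z : ℂ)‖ ≤ ρ →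
      ‖pointEval z (f - dilation v r f)‖ ≤ K * ‖1 - (r : ℂ)‖ * ‖f‖ := by
  obtain ⟨σ, hρσ, hσ1⟩ := exists_between hρ1
  have hσ0 : 0 < σ := hρ0.trans_lt hρσ
  obtain ⟨K, hK, h⟩ := exists_norm_coeff_le v hσ0 hσ1
  have hS := summable_succ_mul_geometric (q := ρ / σ) (by positivity) ((div_lt_one hσ0).2 hρσ)
  refine ⟨K * (∑' n : ℕ, ((n : ℝ) + 1) * (ρ / σ) ^ n) + 1, by positivity, fun f r z hz => ?_⟩
  have h1 := (hasSum_coeffCLM f z).sub (hasSum_coeffCLM f (r * z))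
  rw [← pointEval_dilation, ← map_sub] at h1
  have h2 := (hS.hasSum.mul_left K).mul_right (‖1 - (r : ℂ)‖ * ‖f‖)
  have h3 := tsum_of_norm_bounded h2 (f := fun n => coeffCLM v n f * (z : ℂ) ^ n -
    coeffCLM v n f * ((r * z : 𝔻) : ℂ) ^ n) fun n => by
      have h4 : coeffCLM v n f * (z : ℂ) ^ n - coeffCLM v n f * ((r * z : 𝔻) : ℂ) ^ n =
          coeff f.toHol n * (1 - (r : ℂ) ^ n) * (z : ℂ) ^ n := by
        rw [coeffCLM_apply, Complex.UnitDisc.coe_mul]; ring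
      rw [h4, norm_mul, norm_mul, norm_pow]
      have h5 : ‖1 - (r : ℂ) ^ n‖ ≤ ((n : ℝ) + 1) * ‖1 - (r : ℂ)‖ :=
        (norm_one_sub_pow_le r.norm_lt_one.le n).trans (by gcongr; linarith)
      calc ‖coeff f.toHol n‖ * ‖1 - (r : ℂ) ^ n‖ * ‖(z : ℂ)‖ ^ n
          ≤ K / σ ^ n * ‖f‖ * (((n : ℝ) + 1) * ‖1 - (r : ℂ)‖) * ρ ^ n := by
            gcongr
            exact h f n
        _ = _ := by rw [div_pow]; ring
  rw [h1.tsum_eq] at h3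
  refine h3.trans ?_
  have : 0 ≤ ‖1 - (r : ℂ)‖ * ‖f‖ := by positivity
  rw [mul_assoc _ _ ‖f‖, add_mul]
  linarith

theorem exists_radius {ε : ℝ} (hε : 0 < ε) : ∃ r : 𝔻, ‖1 - (r : ℂ)‖ < ε := by
  have hm : 0 < min ε 1 := lt_min hε one_pos
  have h1 : min ε 1 ≤ 1 := min_le_right _ _
  refine ⟨Complex.UnitDisc.mk ((1 - min ε 1 / 2 : ℝ) : ℂ) ?_, ?_⟩
  · rw [Complex.norm_real, Real.norm_of_nonneg] <;> linarith
  · rw [Complex.UnitDisc.coe_mk, ← Complex.ofReal_one, ← Complex.ofReal_sub, Complex.norm_real,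
      Real.norm_of_nonneg] <;> linarith [min_le_left ε 1]

theorem exists_radius_seq : ∃ r : ℕ → 𝔻, Tendsto (fun n => ‖1 - (r n : ℂ)‖) atTop (𝓝 0) := by
  choose r hr using fun n : ℕ => exists_radius (Nat.one_div_pos_of_nat (α := ℝ) (n := n))
  exact ⟨r, squeeze_zero (fun _ => norm_nonneg _) (fun n => (hr n).le)
    tendsto_one_div_add_atTop_nhds_zero_nat⟩

/-! ### Extension of `C_μ` to `H_v^∞` -/

/-- For `f` in `H_v^∞`, the functions `C_μ (f(r ·))` converge pointwise to `C_μ f`. -/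
theorem tendsto_cesaro_dilation (μ : Measure (Set.Ico (0 : ℝ) 1)) [IsFiniteMeasure μ] (f : HInf v)
    {r : ℕ → 𝔻} (hr : Tendsto (fun n => ‖1 - (r n : ℂ)‖) atTop (𝓝 0)) (z : 𝔻) :
    Tendsto (fun n => (cesaro μ (dilation v (r n) f).toHol : 𝔻 → ℂ) z) atTop
      (𝓝 ((cesaro μ f.toHol : 𝔻 → ℂ) z)) := by
  obtain ⟨ρ, hzρ, hρ1⟩ := exists_between z.norm_lt_one
  obtain ⟨K, hK, h⟩ := exists_norm_cesaro_le μ (norm_nonneg (z : ℂ)) hzρ hρ1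
  obtain ⟨K', hK', h'⟩ := exists_norm_sub_dilation_le v ((norm_nonneg (z : ℂ)).trans hzρ.le) hρ1
  rw [tendsto_iff_norm_sub_tendsto_zero]
  have h0 := (hr.const_mul (K * K')).mul_const ‖f‖
  rw [mul_zero, zero_mul] at h0
  refine squeeze_zero (fun _ => norm_nonneg _) (fun n => ?_) h0
  have h1 := h (f - dilation v (r n) f).toHol _ (fun ζ hζ => h' f (r n) ζ hζ) z le_rfl
  rw [map_sub, map_sub] at h1
  rw [norm_sub_rev]
  exact h1.trans_eq (by ring)

theorem exists_extension (μ : Measure (Set.Ico (0 : ℝ) 1)) [IsFiniteMeasure μ]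
    (T₀ : HZero v →L[ℂ] HZero w)
    (hT₀ : ∀ f : HZero v, (T₀ f : HInf w).toHol = cesaro μ (f : HInf v).toHol) :
    ∃ T : HInf v →L[ℂ] HInf w, ∀ f : HInf v, (T f).toHol = cesaro μ f.toHol := by
  have hb (f : HInf v) (z : 𝔻) :
      w.toFun z * ‖(cesaro μ f.toHol : 𝔻 → ℂ) z‖ ≤ ‖T₀‖ * ‖f‖ := by
    obtain ⟨r, hr⟩ := exists_radius_seq
    refine le_of_tendsto ((tendsto_cesaro_dilation μ f hr z).norm.const_mul (w.toFun z))
      (Eventually.of_forall fun n => ?_)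
    have h1 := mul_norm_pointEval_le z (T₀ ⟨_, dilation_mem_HZero (r n) f⟩ : HInf w)
    rw [pointEval_apply, hT₀] at h1
    refine h1.trans ((T₀.le_opNorm ⟨_, dilation_mem_HZero (r n) f⟩).trans ?_)
    exact mul_le_mul_of_nonneg_left (norm_dilation_le (r n) f) T₀.opNorm_nonneg
  let L : HInf v →ₗ[ℂ] HInf w :=
    LinearMap.codRestrict (growthSubmodule w) ((cesaro μ).comp HInf.toHol)
      fun f => ⟨‖T₀‖ * ‖f‖, by rintro _ ⟨z, rfl⟩; exact hb f z⟩
  exact ⟨L.mkContinuous ‖T₀‖ fun f => norm_le_of_pointEval fun z => hb f z, fun f => rfl⟩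

/-- An operator on weighted spaces of holomorphic functions that acts as `C_μ`. -/
def ActsAsCesaro (μ : Measure (Set.Ico (0 : ℝ) 1)) [IsFiniteMeasure μ]
    (T : HInf v →L[ℂ] HInf w) : Prop :=
  ∀ f : HInf v, (T f).toHol = cesaro μ f.toHol

variable {μ : Measure (Set.Ico (0 : ℝ) 1)} [IsFiniteMeasure μ] {T : HInf v →L[ℂ] HInf w}

theorem ActsAsCesaro.exists_norm_pointEval_le (hT : ActsAsCesaro μ T) {s ρ : ℝ} (hs0 : 0 ≤ s)
    (hsρ : s < ρ) (hρ1 : ρ < 1) :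
    ∃ K > 0, ∀ (f : HInf v) (B : ℝ), (∀ z : 𝔻, ‖(z : ℂ)‖ ≤ ρ → ‖pointEval z f‖ ≤ B) →
      ∀ z : 𝔻, ‖(z : ℂ)‖ ≤ s → ‖pointEval z (T f)‖ ≤ K * B := by
  obtain ⟨K, hK, h⟩ := exists_norm_cesaro_le μ hs0 hsρ hρ1
  refine ⟨K, hK, fun f B hB z hz => ?_⟩
  rw [pointEval_apply, hT f]
  exact h f.toHol B hB z hz

/-- Lets `T` be applied to the sum of the humps, a series shown to converge only locally uniformly,
where norm continuity of `T` does not help. -/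
theorem ActsAsCesaro.tendsto_pointEval (hT : ActsAsCesaro μ T) {F : ℕ → HInf v} {G : HInf v}
    (hF : ∀ ρ < 1, ∀ ε > 0, ∃ N, ∀ n ≥ N, ∀ z : 𝔻, ‖(z : ℂ)‖ ≤ ρ →
      ‖pointEval z (F n) - pointEval z G‖ ≤ ε) (z : 𝔻) :
    Tendsto (fun n => pointEval z (T (F n))) atTop (𝓝 (pointEval z (T G))) := by
  obtain ⟨ρ, hzρ, hρ1⟩ := exists_between z.norm_lt_one
  obtain ⟨K, hK, h⟩ := hT.exists_norm_pointEval_le (norm_nonneg (z : ℂ)) hzρ hρ1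
  refine Metric.tendsto_atTop.2 fun ε hε => ?_
  obtain ⟨N, hN⟩ := hF ρ hρ1 (ε / 2 / K) (by positivity)
  refine ⟨N, fun n hn => ?_⟩
  rw [dist_eq_norm, ← map_sub, ← map_sub]
  refine (h _ _ (fun ζ hζ => ?_) z le_rfl).trans_lt (?_ : K * (ε / 2 / K) < ε)
  · rw [map_sub]
    exact hN n hn ζ hζ
  · rw [mul_div_cancel₀ _ hK.ne']
    exact half_lt_self hε

theorem ActsAsCesaro.tendsto_dilation (hT : ActsAsCesaro μ T) (f : HInf v) {r : ℕ → 𝔻}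
    (hr : Tendsto (fun n => ‖1 - (r n : ℂ)‖) atTop (𝓝 0)) (z : 𝔻) :
    Tendsto (fun n => pointEval z (T (dilation v (r n) f))) atTop (𝓝 (pointEval z (T f))) := by
  simp only [pointEval_apply, hT _]
  exact tendsto_cesaro_dilation μ f hr z

/-! ### The gliding hump -/

/-- The data of one hump of a gliding hump argument: `f` and `T f` are of size at most `e` (with
respect to the weights) off the annulus `ρ < |z| ≤ ρ'`, which contains a point where `T f` is of
size greater than `δ`. -/
structure IsHump (T : HInf v →L[ℂ] HInf w) (δ e ρ ρ' : ℝ) (f : HInf v) (z₀ : 𝔻) : Prop where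
  norm_le : ‖f‖ ≤ 1
  small : ∀ z : 𝔻, ‖(z : ℂ)‖ ≤ ρ ∨ ρ' < ‖(z : ℂ)‖ →
    v.toFun z * ‖pointEval z f‖ ≤ e ∧ w.toFun z * ‖pointEval z (T f)‖ ≤ δ / 4 * e
  large : δ < w.toFun z₀ * ‖pointEval z₀ (T f)‖
  lt_norm : ρ < ‖(z₀ : ℂ)‖
  norm_le_outer : ‖(z₀ : ℂ)‖ ≤ ρ'

/-- Inside, smallness of `f` on a disc slightly larger than `|z| ≤ ρ` controls both `f` and `T f`;
outside, both decay because they lie in `H_v^0` and `H_w^0`. -/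
theorem exists_isHump (hT : ActsAsCesaro μ T) (hT0 : ∀ f ∈ HZero v, T f ∈ HZero w) {δ : ℝ}
    (hδ : 0 < δ)
    (H : ∀ ρ < 1, ∀ ε > 0, ∃ f ∈ HZero v, ‖f‖ ≤ 1 ∧
      (∀ z : 𝔻, ‖(z : ℂ)‖ ≤ ρ → ‖pointEval z f‖ ≤ ε) ∧ δ < ‖T f‖)
    {e : ℝ} (he0 : 0 < e) (he1 : e ≤ 1) (ρ : Set.Ico (0 : ℝ) 1) :
    ∃ (ρ' : Set.Ico (0 : ℝ) 1) (f : HInf v) (z₀ : 𝔻),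
      1 - e ≤ (ρ' : ℝ) ∧ IsHump T δ e ρ ρ' f z₀ := by
  obtain ⟨ρ, hρ0, hρ1⟩ := ρ
  obtain ⟨σ, hρσ, hσ1⟩ := exists_between hρ1
  obtain ⟨K, hK, h⟩ := hT.exists_norm_pointEval_le hρ0 hρσ hσ1
  have hv0 := v.pos 0
  have hw0 := w.pos 0
  -- The weights are largest at `0`, and `K` is the loss under `T`, so these thresholds become `e`
  -- and `δ / 4 * e`.
  obtain ⟨f, hf0, hf1, hfs, hfl⟩ := H σ hσ1
    (min (e / v.toFun 0) (δ / 4 * e / (w.toFun 0 * K))) (lt_min (by positivity) (by positivity))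
  obtain ⟨z₀, hz₀⟩ := exists_lt_of_lt_norm hfl
  obtain ⟨ρ₁, hρ₁, h1⟩ := mem_HZero_iff.1 hf0 e he0
  obtain ⟨ρ₂, hρ₂, h2⟩ := mem_HZero_iff.1 (hT0 f hf0) (δ / 4 * e) (by positivity)
  have hin (z : 𝔻) (hz : ‖(z : ℂ)‖ ≤ ρ) :
      v.toFun z * ‖pointEval z f‖ ≤ e ∧ w.toFun z * ‖pointEval z (T f)‖ ≤ δ / 4 * e := by
    constructor
    · have h3 := (hfs z (hz.trans hρσ.le)).trans (min_le_left _ _)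
      rw [le_div_iff₀' hv0] at h3
      exact (mul_le_mul_of_nonneg_right (v.le_zero z) (norm_nonneg _)).trans h3
    · have h3 := (h f _ hfs z hz).trans (mul_le_mul_of_nonneg_left (min_le_right _ _) hK.le)
      refine (mul_le_mul (w.le_zero z) h3 (norm_nonneg _) hw0.le).trans_eq ?_
      field_simp
  -- The entry `1 - e` forces the radii of successive humps to tend to `1`.
  refine ⟨⟨max (max ρ₁ ρ₂) (max ‖(z₀ : ℂ)‖ (1 - e)),
    (norm_nonneg _).trans ((le_max_left _ _).trans (le_max_right _ _)),
    max_lt (max_lt hρ₁ hρ₂) (max_lt z₀.norm_lt_one (by linarith))⟩, f, z₀,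
    (le_max_right _ _).trans (le_max_right _ _), hf1, ?_, hz₀, ?_,
    (le_max_left _ _).trans (le_max_right _ _)⟩
  · rintro z (hz | hz)
    · exact hin z hz
    · have hz' := (le_max_left _ _).trans_lt hz
      exact ⟨(h1 z ((le_max_left _ _).trans_lt hz')).le,
        (h2 z ((le_max_right _ _).trans_lt hz')).le⟩
  · by_contra! hz
    have h3 := (hin z₀ hz).2
    have h4 : δ / 4 * e ≤ δ / 4 * 1 := by gcongr
    linarith

theorem sum_le_add_of_ne {a e : ℕ → ℝ} {b : ℝ} (k : ℕ) (he : ∀ j, 0 ≤ e j) (hb : 0 ≤ b)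
    (hk : a k ≤ b) (h : ∀ j ≠ k, a j ≤ e j) (s : Finset ℕ) :
    ∑ j ∈ s, a j ≤ ∑ j ∈ s, e j + b := by
  have h1 : ∀ j ∈ s, a j ≤ e j + if k = j then b else 0 := fun j _ => by
    split_ifs with hj
    · subst hj
      linarith [he k]
    · simpa using h j (Ne.symm hj)
  refine (Finset.sum_le_sum h1).trans ?_
  rw [Finset.sum_add_distrib, Finset.sum_ite_eq]
  split_ifs <;> linarith

/-- A gliding hump argument: the humps add up to a function in `H_v^∞` whose image under `C_μ` is
not in `H_w^0`. -/
theorem exists_notMem_HZero (hT : ActsAsCesaro μ T) (hT0 : ∀ f ∈ HZero v, T f ∈ HZero w) {δ : ℝ}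
    (hδ : 0 < δ)
    (H : ∀ ρ < 1, ∀ ε > 0, ∃ f ∈ HZero v, ‖f‖ ≤ 1 ∧
      (∀ z : 𝔻, ‖(z : ℂ)‖ ≤ ρ → ‖pointEval z f‖ ≤ ε) ∧ δ < ‖T f‖) :
    ∃ f, T f ∉ HZero w := by
  have step (k : ℕ) (ρ : Set.Ico (0 : ℝ) 1) := exists_isHump hT hT0 hδ H
    (e := (1 / 2 : ℝ) ^ k) (by positivity) (pow_le_one₀ (by norm_num) (by norm_num)) ρ
  choose R F Z hR hhump using step
  obtain ⟨ρ, hρR⟩ : ∃ ρ : ℕ → Set.Ico (0 : ℝ) 1, ∀ k, ρ (k + 1) = R k (ρ k) :=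
    ⟨fun k => Nat.rec ⟨0, le_rfl, one_pos⟩ R k, fun _ => rfl⟩
  let f : ℕ → HInf v := fun k => F k (ρ k)
  let ζ : ℕ → 𝔻 := fun k => Z k (ρ k)
  have hρ (k : ℕ) : 1 - (1 / 2 : ℝ) ^ k ≤ (ρ (k + 1) : ℝ) := hρR k ▸ hR k (ρ k)
  have hf (k : ℕ) : IsHump T δ ((1 / 2 : ℝ) ^ k) (ρ k : ℝ) (ρ (k + 1) : ℝ) (f k) (ζ k) :=
    hρR k ▸ hhump k (ρ k)
  have hmono : Monotone fun k => (ρ k : ℝ) :=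
    monotone_nat_of_le_succ fun k => (hf k).lt_norm.le.trans (hf k).norm_le_outer
  have hlim (s : ℝ) (hs : s < 1) : ∃ k, s ≤ (ρ k : ℝ) := by
    obtain ⟨k, hk⟩ := exists_pow_lt_of_lt_one (sub_pos.2 hs) (by norm_num : (1 / 2 : ℝ) < 1)
    exact ⟨k + 1, by linarith [hρ k]⟩
  have hother {k : ℕ} {z : 𝔻} (h1 : (ρ k : ℝ) < ‖(z : ℂ)‖) (h2 : ‖(z : ℂ)‖ ≤ ρ (k + 1)) (j : ℕ)
      (hj : j ≠ k) := (hf j).small z <| by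
    rcases lt_or_gt_of_ne hj with hj | hj
    · exact Or.inr ((hmono hj).trans_lt h1)
    · exact Or.inl (h2.trans (hmono hj))
  -- The annuli are disjoint, so at most one hump is not small at `z`; if there is none, any index
  -- will do.
  have hone (z : 𝔻) : ∃ k, ∀ j ≠ k, v.toFun z * ‖pointEval z (f j)‖ ≤ (1 / 2 : ℝ) ^ j := by
    by_cases h : ∃ k, (ρ k : ℝ) < ‖(z : ℂ)‖ ∧ ‖(z : ℂ)‖ ≤ ρ (k + 1)
    · obtain ⟨k, h1, h2⟩ := h
      exact ⟨k, fun j hj => (hother h1 h2 j hj).1⟩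
    · push Not at h
      exact ⟨0, fun j _ => ((hf j).small z ((le_or_gt _ _).imp_right (h j))).1⟩
  let S : ℕ → HInf v := fun n => ∑ j ∈ Finset.range n, f j
  -- At most `2` from the geometric series and `1` from the exceptional hump.
  have hS (n : ℕ) : ‖S n‖ ≤ 3 := norm_le_of_pointEval fun z => by
    obtain ⟨k, hk⟩ := hone z
    have h1 := sum_le_add_of_ne (b := 1) k (fun j => by positivity) one_pos.le
      ((mul_norm_pointEval_le z (f k)).trans (hf k).norm_le) hk (Finset.range n)
    have h2 := sum_geometric_two_le n
    rw [map_sum]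
    refine (mul_le_mul_of_nonneg_left (norm_sum_le _ _) (v.pos z).le).trans ?_
    rw [Finset.mul_sum]
    linarith
  obtain ⟨G, -, hG⟩ := exists_limit_of_locally_cauchy hS fun s hs ε hε => by
    obtain ⟨c, hc, hvc⟩ := v.exists_pos_le hs
    obtain ⟨k, hk⟩ := hlim s hs
    obtain ⟨l, hl⟩ := exists_pow_lt_of_lt_one (show 0 < ε * c / 2 by positivity)
      (by norm_num : (1 / 2 : ℝ) < 1)
    have key (m n : ℕ) (hm : max k l ≤ m) (hmn : m ≤ n) (z : 𝔻) (hz : ‖(z : ℂ)‖ ≤ s) :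
        ‖pointEval z (S n) - pointEval z (S m)‖ ≤ ε := by
      rw [← map_sub, ← Finset.sum_Ico_eq_sub _ hmn, map_sum]
      have h1 : ∀ j ∈ Finset.Ico m n, ‖pointEval z (f j)‖ ≤ (1 / 2 : ℝ) ^ j / c := fun j hj => by
        have hj' := (le_max_left _ _).trans (hm.trans (Finset.mem_Ico.1 hj).1)
        rw [le_div_iff₀' hc]
        exact (mul_le_mul_of_nonneg_right (hvc z hz) (norm_nonneg _)).trans
          ((hf j).small z (Or.inl (hz.trans (hk.trans (hmono hj'))))).1
      refine (norm_sum_le_of_le _ h1).trans ?_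
      rw [← Finset.sum_div, div_le_iff₀ hc]
      have h2 := geom_sum_Ico_le_of_lt_one (x := (1 / 2 : ℝ)) (m := m) (n := n) (by norm_num)
        (by norm_num)
      have h2' : (1 / 2 : ℝ) ^ m / (1 - 1 / 2) = 2 * (1 / 2) ^ m := by ring
      have h3 : (1 / 2 : ℝ) ^ m ≤ (1 / 2) ^ l := pow_le_pow_of_le_one (by norm_num) (by norm_num)
        ((le_max_right _ _).trans hm)
      linarith
    refine ⟨max k l, fun n hn m hm z hz => ?_⟩
    rcases le_total m n with h | h
    · exact key m n hm h z hz
    · rw [norm_sub_rev]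
      exact key n m hn h z hz
  refine ⟨G, fun hmem => ?_⟩
  obtain ⟨s, hs, h⟩ := mem_HZero_iff.1 hmem (δ / 2) (half_pos hδ)
  obtain ⟨k, hk⟩ := hlim s hs
  -- At `ζ k` the `k`-th image exceeds `δ` and all the others together contribute at most `δ / 4 *
  -- 2`, so `δ / 2` survives in the limit.
  refine (h (ζ k) (hk.trans_lt (hf k).lt_norm)).not_ge ?_
  refine ge_of_tendsto ((hT.tendsto_pointEval hG (ζ k)).norm.const_mul (w.toFun (ζ k))) ?_
  filter_upwards [eventually_gt_atTop k] with n hn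
  have hw := w.pos (ζ k)
  have h1 : pointEval (ζ k) (T (f k)) = pointEval (ζ k) (T (S n)) -
      ∑ j ∈ (Finset.range n).erase k, pointEval (ζ k) (T (f j)) := by
    rw [map_sum, map_sum, eq_sub_iff_add_eq, Finset.add_sum_erase _ (fun j => pointEval (ζ k) (T (f j)))
      (Finset.mem_range.2 hn)]
  have h2 : w.toFun (ζ k) * ‖∑ j ∈ (Finset.range n).erase k, pointEval (ζ k) (T (f j))‖ ≤
      δ / 4 * 2 := by
    refine (mul_le_mul_of_nonneg_left (norm_sum_le _ _) hw.le).trans ?_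
    rw [Finset.mul_sum]
    calc ∑ j ∈ (Finset.range n).erase k, w.toFun (ζ k) * ‖pointEval (ζ k) (T (f j))‖
        ≤ ∑ j ∈ (Finset.range n).erase k, δ / 4 * (1 / 2 : ℝ) ^ j :=
          Finset.sum_le_sum fun j hj =>
            (hother (hf k).lt_norm (hf k).norm_le_outer j (Finset.ne_of_mem_erase hj)).2
      _ ≤ ∑ j ∈ Finset.range n, δ / 4 * (1 / 2 : ℝ) ^ j :=
          Finset.sum_le_sum_of_subset_of_nonneg (Finset.erase_subset _ _)
            fun j _ _ => by positivity
      _ ≤ δ / 4 * 2 := by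
          rw [← Finset.mul_sum]
          exact mul_le_mul_of_nonneg_left (sum_geometric_two_le n) (by positivity)
  have h3 := (hf k).large
  have h4 := mul_le_mul_of_nonneg_left (norm_sub_le (pointEval (ζ k) (T (S n)))
    (∑ j ∈ (Finset.range n).erase k, pointEval (ζ k) (T (f j)))) hw.le
  rw [← h1] at h4
  linarith

/-! ### Compactness -/

/-- If `C_μ` maps `H_v^∞` into `H_w^0`, then it is approximated in norm by its compositions with
dilations. -/
theorem exists_norm_sub_comp_dilation_le (hT : ActsAsCesaro μ T) (hT0 : ∀ f, T f ∈ HZero w)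
    {ε : ℝ} (hε : 0 < ε) : ∃ r : 𝔻, ‖T - T.comp (dilation v r)‖ ≤ ε := by
  by_contra! hcon
  obtain ⟨f, hf⟩ := exists_notMem_HZero hT (fun f _ => hT0 f) (half_pos hε)
    fun ρ hρ η hη => by
      obtain ⟨K, hK, h⟩ := exists_norm_sub_dilation_le v (le_max_right ρ 0) (max_lt hρ one_pos)
      obtain ⟨r, hr⟩ := exists_radius (show 0 < η / K by positivity)
      obtain ⟨f, hf⟩ : ∃ f, ε * ‖f‖ < ‖(T - T.comp (dilation v r)) f‖ := by
        by_contra! h'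
        exact (ContinuousLinearMap.opNorm_le_bound _ hε.le h').not_gt (hcon r)
      have hf0 : 0 < ‖f‖ := norm_pos_iff.2 fun h0 => by simp [h0] at hf
      set g := f - dilation v r f with hg
      have hTg : ε * ‖f‖ < ‖T g‖ := by simpa [hg] using hf
      have hg2 : ‖g‖ ≤ 2 * ‖f‖ := by
        linarith [norm_sub_le f (dilation v r f), norm_dilation_le r f]
      have hgρ (z : 𝔻) (hz : ‖(z : ℂ)‖ ≤ ρ) : ‖pointEval z g‖ ≤ η * ‖f‖ := by
        refine (h f r z (hz.trans (le_max_left _ _))).trans ?_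
        rw [lt_div_iff₀' hK] at hr
        gcongr
      have hc : ‖((2 * ‖f‖ : ℝ) : ℂ)⁻¹‖ = (2 * ‖f‖)⁻¹ := by
        rw [norm_inv, Complex.norm_real, Real.norm_of_nonneg (by positivity)]
      -- Since `‖g‖ ≤ 2 * ‖f‖`, this puts `p` in the unit ball and halves the lower bound `ε`.
      set p := ((2 * ‖f‖ : ℝ) : ℂ)⁻¹ • g with hp
      obtain ⟨z, hz⟩ : ∃ z, ε / 2 < w.toFun z * ‖pointEval z (T p)‖ := by
        refine exists_lt_of_lt_norm ?_
        rw [hp, map_smul, norm_smul, hc, inv_mul_eq_div, lt_div_iff₀ (by positivity)]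
        linarith
      -- A second dilation moves `p` into `H_v^0`; pointwise convergence at the single point `z`
      -- keeps the image large.
      obtain ⟨t, ht⟩ := exists_radius_seq
      obtain ⟨n, hn⟩ := (((hT.tendsto_dilation p ht z).norm.const_mul
        (w.toFun z)).eventually (lt_mem_nhds hz)).exists
      refine ⟨dilation v (t n) p, dilation_mem_HZero _ _, (norm_dilation_le _ _).trans ?_,
        fun y hy => ?_, hn.trans_le (mul_norm_pointEval_le z _)⟩
      · rw [hp, norm_smul, hc, inv_mul_eq_div]
        exact div_le_one_of_le₀ hg2 (by positivity)
      · rw [pointEval_dilation, hp, map_smul, norm_smul, hc, inv_mul_eq_div,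
          div_le_iff₀ (by positivity)]
        refine (hgρ _ ?_).trans (by nlinarith [mul_pos hη hf0])
        rw [Complex.UnitDisc.coe_mul, norm_mul]
        exact (mul_le_of_le_one_left (norm_nonneg _) (t n).norm_lt_one.le).trans hy
  exact hf (hT0 f)

theorem isCompactOperator_of_forall_mem_HZero (hT : ActsAsCesaro μ T)
    (hT0 : ∀ f, T f ∈ HZero w) : IsCompactOperator T := by
  have hmem : T ∈ closure {S : HInf v →L[ℂ] HInf w | IsCompactOperator S} := by
    refine Metric.mem_closure_iff.2 fun ε hε => ?_
    obtain ⟨r, hr⟩ := exists_norm_sub_comp_dilation_le hT hT0 (half_pos hε)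
    refine ⟨T.comp (dilation v r), (isCompactOperator_dilation v r).clm_comp T, ?_⟩
    rw [dist_eq_norm]
    exact hr.trans_lt (half_lt_self hε)
  exact isClosed_setOfPred_isCompactOperator.closure_subset hmem

theorem forall_mem_HZero_of_isCompactOperator (hT : ActsAsCesaro μ T)
    {T₀ : HZero v →L[ℂ] HZero w} (hT₀ : ∀ f : HZero v, (T₀ f : HInf w) = T f)
    (hc : IsCompactOperator T₀) (f : HInf v) : T f ∈ HZero w := by
  obtain ⟨K, hK, hsub⟩ := hc.image_closedBall_subset_compact (𝕜₁ := ℂ) (𝕜₂ := ℂ)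
    (σ₁₂ := RingHom.id ℂ) (f := T₀.toLinearMap) ‖f‖
  obtain ⟨r, hr⟩ := exists_radius_seq
  have hin (n : ℕ) : T₀ ⟨_, dilation_mem_HZero (r n) f⟩ ∈ K := by
    refine hsub ⟨⟨_, dilation_mem_HZero (r n) f⟩, ?_, rfl⟩
    rw [mem_closedBall_zero_iff]
    exact norm_dilation_le (r n) f
  obtain ⟨g, -, ψ, hψ, hg⟩ := hK.tendsto_subseq hin
  have hfg : T f = g := HInf.ext_pointEval fun z => by
    have h1 := ((pointEval z).continuous.tendsto (g : HInf w)).comp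
      ((continuous_subtype_val.tendsto g).comp hg)
    refine tendsto_nhds_unique ((hT.tendsto_dilation f hr z).comp hψ.tendsto_atTop) ?_
    refine h1.congr fun n => ?_
    simp only [Function.comp_apply, hT₀]
  rw [hfg]
  exact g.2

end WeightedCesaro

end

open WeightedCesaro in
theorem proposition2p4 (μ : MeasureTheory.Measure (Set.Ico (0 : ℝ) 1))
    [MeasureTheory.IsFiniteMeasure μ] (v w : WeightedCesaro.Weight)
    (T₀ : HZero v →L[ℂ] HZero w)
    (hT₀ : ∀ f : HZero v, (T₀ f : HInf w).toHol = cesaro μ (f : HInf v).toHol) :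
    ∃ T : HInf v →L[ℂ] HInf w, (∀ f : HInf v, (T f).toHol = cesaro μ f.toHol) ∧
      (IsCompactOperator T₀ ↔
        ∀ f : HInf v, ∃ g ∈ HZero w, HInf.toHol g = cesaro μ f.toHol) ∧
      (IsCompactOperator T ↔
        ∀ f : HInf v, ∃ g ∈ HZero w, HInf.toHol g = cesaro μ f.toHol) := by
  obtain ⟨T, hT⟩ := exists_extension μ T₀ hT₀
  have hinj : Function.Injective (HInf.toHol (v := w)) := Subtype.val_injective
  have hTT₀ (f : HZero v) : (T₀ f : HInf w) = T f := hinj ((hT₀ f).trans (hT f).symm)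
  have hiff : (∀ f : HInf v, ∃ g ∈ HZero w, HInf.toHol g = cesaro μ f.toHol) ↔
      ∀ f, T f ∈ HZero w := by
    refine forall_congr' fun f => ⟨?_, fun h => ⟨T f, h, hT f⟩⟩
    rintro ⟨g, hg, hgf⟩
    rwa [hinj ((hT f).trans hgf.symm)]
  have h1 : IsCompactOperator T → IsCompactOperator T₀ := fun h => by
    -- Compactness survives shrinking the codomain because `HZero w` is closed.
    have h' := (h.comp_clm (HZero v).subtypeL).codRestrict (V := HZero w)
      (fun f => (hTT₀ f).subst (motive := (· ∈ HZero w)) (T₀ f).2) (isClosed_HZero w)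
    refine (congrArg IsCompactOperator (funext fun f => Subtype.ext ?_)).mpr h'
    exact hTT₀ f
  have h2 : IsCompactOperator T₀ → ∀ f, T f ∈ HZero w :=
    forall_mem_HZero_of_isCompactOperator hT hTT₀
  have h3 : (∀ f, T f ∈ HZero w) → IsCompactOperator T := isCompactOperator_of_forall_mem_HZero hT
  rw [hiff]
  exact ⟨T, hT, ⟨h2, fun h => h1 (h3 h)⟩, ⟨fun h => h2 (h1 h), h3⟩⟩
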